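/- Let $d\ge 1$ and let $\Omega\subset\mathbb{R}^d$ be a bounded connected open set with boundary of class $C^2$. Let $L:\mathbb{R}^d\times\mathbb{R}^d\to\mathbb{R}$ be a Tonelli Lagrangian: $L$ is of class $C^2$; $D^2_{vv}L(x,v)$ is positive definite for all $(x,v)$; for every $K\ge 0$ there is $C(K)\in\mathbb{R}$ with $L(x,v)\ge K|v|-C(K)$ for all $(x,v)$; and $\sup\{L(x,v): x\in\mathbb{R}^d,\ |v|\le R\}<+\infty$ for every $R\ge 0$. Let $H(x,p)=\sup_{v\in\mathbb{R}^d}\{\langle p,v\rangle-L(x,v)\}$ be the associated Hamiltonian, and assume that it is reversible, i.e. $H(x,-p)=H(x,p)$ for all $(x,p)$. Assume (A1) $\ \operatorname{argmin}_{x\in\mathbb{R}^d}L(x,0)\cap\overline\Omega\neq\emptyset$. A function $u\in C(\overline\Omega)$ is a constrained viscosity solution of $H(x,Du)=c$ on $\overline\Omega$ if, for every $\varphi\in C^1(\mathbb{R}^d)$, $H(x_0,D\varphi(x_0))\le c$ at every local maximum point $x_0\in\Omega$ of $u-\varphi$ on $\Omega$, and $H(x_0,D\varphi(x_0))\ge c$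 at every local minimum point $x_0\in\overline\Omega$ of $u-\varphi$ relative to $\overline\Omega$. Then there is exactly one constant $c_H\in\mathbb{R}$ such that $H(x,Du)=c_H$ has a constrained viscosity solution on $\overline\Omega$; Mañé's critical value $$c_L:=\sup\Big\{k\in\mathbb{R}:\ \int_a^b\big(L(\gamma(s),\dot\gamma(s))+k\big)\,ds<0\ \text{ for some } a<b \text{ and some absolutely continuous } \gamma:[a,b]\to\mathbb{R}^d \text{ with } \gamma(a)=\gamma(b)\Big\}$$ is a finite supremum; and $$c_H=c_L=-\min_{x\in\mathbb{R}^d}L(x,0).$$ -/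

import Mathlib

open Set Topology

noncomputable section

/-- `ℝ^d` with its Euclidean structure. -/
abbrev Eucl (d : ℕ) : Type := EuclideanSpace ℝ (Fin d)

/-- Tonelli Lagrangians on `ℝ^d × ℝ^d`: of class `C²`, with positive definite second derivative in
the velocity, uniformly superlinear in the velocity, and bounded above on `ℝ^d × {|v| ≤ R}` for
every `R`. -/
structure IsTonelli {d : ℕ} (L : Eucl d → Eucl d → ℝ) : Prop where
  contDiff : ContDiff ℝ 2 (fun z : Eucl d × Eucl d => L z.1 z.2)
  posDef : ∀ x v w : Eucl d, w ≠ 0 → 0 < fderiv ℝ (fderiv ℝ (L x)) v w w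
  superlinear : ∀ K : ℝ, ∃ C : ℝ, ∀ x v : Eucl d, K * ‖v‖ - C ≤ L x v
  bounded : ∀ R : ℝ, ∃ A : ℝ, ∀ x v : Eucl d, ‖v‖ ≤ R → L x v ≤ A

/-- The Hamiltonian associated with `L`: `H(x,p) = sup_v (⟨p,v⟩ - L(x,v))`. -/
def hamiltonian {d : ℕ} (L : Eucl d → Eucl d → ℝ) (x p : Eucl d) : ℝ :=
  ⨆ v : Eucl d, (inner ℝ p v - L x v)

/-- The Hamiltonian is even in the momentum. -/
def IsReversible {d : ℕ} (H : Eucl d → Eucl d → ℝ) : Prop :=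
  ∀ x p : Eucl d, H x (-p) = H x p

/-- The boundary of `Ω` is of class `C²`: near each of its points, `Ω` is the set where a `C²`
function with non-vanishing differential at that point is negative. -/
def HasC2Boundary {d : ℕ} (Ω : Set (Eucl d)) : Prop :=
  ∀ x ∈ frontier Ω, ∃ (U : Set (Eucl d)) (b : Eucl d → ℝ),
    IsOpen U ∧ x ∈ U ∧ ContDiffOn ℝ 2 b U ∧ fderiv ℝ b x ≠ 0 ∧ Ω ∩ U = {y ∈ U | b y < 0}

/-- The set of all real `k` such that `A_{L+k}(γ) < 0` for some closed absolutely continuous curve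
`γ : [a,b] → ℝ^d`, `a < b`. For a Lagrangian that is bounded below, the action of a curve along
which it is not integrable is `+∞`, so such curves do not count. -/
def negativeActionLevels {d : ℕ} (L : Eucl d → Eucl d → ℝ) : Set ℝ :=
  {k | ∃ (a b : ℝ) (γ : ℝ → Eucl d), a < b ∧ AbsolutelyContinuousOnInterval γ a b ∧ γ a = γ b ∧
    IntervalIntegrable (fun s => L (γ s) (deriv γ s)) MeasureTheory.volume a b ∧
    ∫ s in a..b, (L (γ s) (deriv γ s) + k) < 0}

/-- Mañé's critical value `c_L`. -/
def maneCriticalValue {d : ℕ} (L : Eucl d → Eucl d → ℝ) : ℝ :=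
  sSup (negativeActionLevels L)

/-- `u` is a viscosity subsolution of `H(x,Du) = c` on `S`; maxima are relative to `S`. -/
def IsViscositySubsolutionOn {d : ℕ} (S : Set (Eucl d)) (H : Eucl d → Eucl d → ℝ) (c : ℝ)
    (u : Eucl d → ℝ) : Prop :=
  ∀ φ : Eucl d → ℝ, ContDiff ℝ 1 φ → ∀ x₀ ∈ S,
    IsLocalMaxOn (fun x => u x - φ x) S x₀ → H x₀ (gradient φ x₀) ≤ c

/-- `u` is a viscosity supersolution of `H(x,Du) = c` on `S`; minima are relative to `S`. -/
def IsViscositySupersolutionOn {d : ℕ} (S : Set (Eucl d)) (H : Eucl d → Eucl d → ℝ) (c : ℝ)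
    (u : Eucl d → ℝ) : Prop :=
  ∀ φ : Eucl d → ℝ, ContDiff ℝ 1 φ → ∀ x₀ ∈ S,
    IsLocalMinOn (fun x => u x - φ x) S x₀ → c ≤ H x₀ (gradient φ x₀)

/-- `u` is a constrained viscosity solution of `H(x,Du) = c` on the closure of `Ω`. Only the values
of `u` on that closure matter. -/
def IsConstrainedViscositySolution {d : ℕ} (Ω : Set (Eucl d)) (H : Eucl d → Eucl d → ℝ) (c : ℝ)
    (u : Eucl d → ℝ) : Prop :=
  ContinuousOn u (closure Ω) ∧ IsViscositySubsolutionOn Ω H c u ∧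
    IsViscositySupersolutionOn (closure Ω) H c u

/-- The state constraint problem `H(x,Du) ≤ c` in `Ω`, `H(x,Du) ≥ c` on the closure of `Ω`, has a
solution. -/
def StateConstraintSolvable {d : ℕ} (Ω : Set (Eucl d)) (H : Eucl d → Eucl d → ℝ) (c : ℝ) : Prop :=
  ∃ u : Eucl d → ℝ, IsConstrainedViscositySolution Ω H c u

/-- The state-constrained critical value `c_H`: the constant for which the state constraint problem
has a solution (meaningful when there is exactly one such constant). -/
def constrainedCriticalValue {d : ℕ} (Ω : Set (Eucl d)) (H : Eucl d → Eucl d → ℝ) : ℝ :=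
  Classical.epsilon (StateConstraintSolvable Ω H)

end

/-!
A constrained solution at level `c` satisfies `c ≤ H(x,0)` at its minimum over the closure of `Ω`,
and `H(x,p) ≤ c` on a dense set of points of `Ω`, where it is touched from above by a paraboloid.
Reversibility makes `L(x,·)` minimal at the zero velocity, that is `H(x,0) = -L(x,0)`, so the first
inequality gives `c ≤ -min L(·,0)`; as `H(x,p) ≥ -L(x,0)`, the second one gives `c ≥ -L(z,0)` for
every `z` in the closure of `Ω`, and by (A1) these bounds coincide.

For the existence at `c = -L(z,0)`, where `z` minimizes `L(·,0)`, take the largest function that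
vanishes at `z` and is dominated by the nonnegative Lagrangian `L + c`. The boundary regularity and
connectedness make dominated functions locally equi-Lipschitz up to the boundary. Away from `z`,
failure of the supersolution property would allow a local increase of the function; at `z` itself,
`H(z,p) ≥ -L(z,0) = c` for free. Finally, `L + k ≥ 0` when `k ≥ -L(z,0)`, while resting at `z` has
negative action when `k < -L(z,0)`.
-/

section Metric

variable {ι X : Type*} [PseudoMetricSpace X]

/-- The family `f` is equi-Lipschitz near every point of `S`: the local version, uniform in the
index, of `LocallyLipschitzOn`. -/
def LocallyEquiLipschitzOn (S : Set X) (f : ι → X → ℝ) : Prop :=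
  ∀ ⦃y⦄, y ∈ S → ∃ C : NNReal, ∃ t ∈ 𝓝[S] y, ∀ i, LipschitzOnWith C (f i) t

namespace LocallyEquiLipschitzOn

variable {S : Set X} {f : ι → X → ℝ}

theorem bddAbove_range (hf : LocallyEquiLipschitzOn S f) (hS : IsPreconnected S) {x y : X}
    (hx : x ∈ S) (hy : y ∈ S) (hbdd : BddAbove (range fun i => f i x)) :
    BddAbove (range fun i => f i y) := by
  refine (hS.induction₂ (fun x y => BddAbove (range fun i => f i x) ↔
    BddAbove (range fun i => f i y)) (fun w hw => ?_) (fun _ _ _ _ _ _ => Iff.trans)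
    (fun _ _ _ _ => Iff.symm) hx hy).1 hbdd
  obtain ⟨C, t, ht, hlip⟩ := hf hw
  have transfer : ∀ a ∈ t, ∀ b ∈ t, BddAbove (range fun i => f i a) →
      BddAbove (range fun i => f i b) := by
    rintro a ha b hb ⟨M, hM⟩
    refine ⟨M + C * dist b a, forall_mem_range.2 fun i => ?_⟩
    linarith [hM (mem_range_self i), (hlip i).le_add_mul hb ha]
  have hwt := mem_of_mem_nhdsWithin hw ht
  filter_upwards [ht] with b hb using ⟨transfer w hwt b hb, transfer b hb w hwt⟩

theorem locallyLipschitzOn_iSup [Nonempty ι] (hf : LocallyEquiLipschitzOn S f)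
    (hbdd : ∀ x ∈ S, BddAbove (range fun i => f i x)) :
    LocallyLipschitzOn S fun x => ⨆ i, f i x := by
  intro y hy
  obtain ⟨C, t, ht, hlip⟩ := hf hy
  refine ⟨C, t ∩ S, Filter.inter_mem ht self_mem_nhdsWithin,
    LipschitzOnWith.of_le_add_mul _ fun a ha b hb => ciSup_le fun i => ?_⟩
  linarith [(hlip i).le_add_mul ha.1 hb.1, le_ciSup (hbdd b hb.2) i]

end LocallyEquiLipschitzOn

theorem exists_isLocalMax_sub_mul_dist_sq [ProperSpace X] {u : X → ℝ} {y : X} {r : ℝ}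
    (hr : 0 < r) (hu : ContinuousOn u (Metric.closedBall y r)) :
    ∃ k : ℝ, ∃ x ∈ Metric.ball y r, IsLocalMax (fun x => u x - k * dist x y ^ 2) x := by
  obtain ⟨M, hM⟩ := (isCompact_closedBall y r).bddAbove_image hu
  have hy := Metric.mem_closedBall_self (x := y) hr.le
  set k : ℝ := (M - u y + 1) / r ^ 2 with hk
  have hkr : k * r ^ 2 = M - u y + 1 := by rw [hk]; field_simp
  obtain ⟨x, hx, hmin⟩ := Metric.exists_isLocalMin_mem_ball
    (f := fun x => k * dist x y ^ 2 - u x) (by fun_prop) hy fun x hx => by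
      rw [dist_self, Metric.mem_sphere.1 hx, hkr]
      linarith [hM (mem_image_of_mem u (Metric.sphere_subset_closedBall hx))]
  exact ⟨k, x, hx, by simpa only [neg_sub] using hmin.neg⟩

theorem exists_forall_le_add_mul_dist_sq {S : Set X} {f : X → ℝ} {x₀ : X}
    (hbdd : BddBelow (f '' S)) (hmin : IsLocalMinOn f S x₀) :
    ∃ k : ℝ, ∀ x ∈ S, f x₀ ≤ f x + k * dist x x₀ ^ 2 := by
  obtain ⟨m, hm⟩ := hbdd
  obtain ⟨r, hr, hball⟩ := Metric.eventually_nhds_iff.1 (eventually_nhdsWithin_iff.1 hmin)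
  refine ⟨|f x₀ - m| / r ^ 2, fun x hx => ?_⟩
  rcases lt_or_ge (dist x x₀) r with hxr | hxr
  · exact (hball hxr hx).trans (le_add_of_nonneg_right (by positivity))
  · have hle : |f x₀ - m| ≤ |f x₀ - m| / r ^ 2 * dist x x₀ ^ 2 := by
      rw [div_mul_eq_mul_div, le_div_iff₀ (by positivity)]
      gcongr
    linarith [hm (mem_image_of_mem f hx), le_abs_self (f x₀ - m)]

end Metric

section Cone

variable {E : Type*} [NormedAddCommGroup E] [NormedSpace ℝ E] {Ω : Set E}

/-- The local uniform cone property, which characterizes Lipschitz domains: near each point of the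
closure of `Ω` there is a cone `{s • n + e | M * ‖e‖ ≤ s}` along which one never leaves `Ω` before
leaving the neighborhood `U`. -/
def HasUniformConeProperty (Ω : Set E) : Prop :=
  ∀ z ∈ closure Ω, ∃ (n : E) (M : NNReal), ∃ U ∈ 𝓝 z, ∀ x ∈ Ω ∩ U, ∀ (s : ℝ) (e : E),
    M * ‖e‖ ≤ s → x + (s • n + e) ∈ U → x + (s • n + e) ∈ Ω

theorem segment_subset_of_cone {U V : Set E} {n x e : E} {M s : ℝ}
    (hcone : ∀ x ∈ Ω ∩ U, ∀ (s : ℝ) (e : E), M * ‖e‖ ≤ s → x + (s • n + e) ∈ U →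
      x + (s • n + e) ∈ Ω) (hV : Convex ℝ V) (hVU : V ⊆ U) (hx : x ∈ Ω ∩ V)
    (he : M * ‖e‖ ≤ s) (hmem : x + (s • n + e) ∈ V) : segment ℝ x (x + (s • n + e)) ⊆ Ω := by
  intro y hy
  have hyU := hVU (hV.segment_subset hx.2 hmem hy)
  rw [segment_eq_image'] at hy
  obtain ⟨θ, hθ, rfl⟩ := hy
  beta_reduce at hyU ⊢
  rw [add_sub_cancel_left, smul_add, smul_smul] at hyU ⊢
  refine hcone x ⟨hx.1, hVU hx.2⟩ _ _ ?_ hyU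
  rw [norm_smul, Real.norm_of_nonneg hθ.1, mul_left_comm]
  exact mul_le_mul_of_nonneg_left he hθ.1

/-- Moving from `x` along the axis of the cone, by a distance proportional to `‖x - y‖`, one
reaches a point which also lies in the cone with vertex `y`. -/
theorem HasUniformConeProperty.exists_segment_subset (hΩ : HasUniformConeProperty Ω) {z : E}
    (hz : z ∈ closure Ω) : ∃ C : NNReal, ∃ V ∈ 𝓝 z, ∀ x ∈ Ω ∩ V, ∀ y ∈ Ω ∩ V, ∃ p,
      (segment ℝ x p ⊆ Ω ∧ ‖p - x‖ ≤ C * ‖x - y‖) ∧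
      (segment ℝ y p ⊆ Ω ∧ ‖p - y‖ ≤ C * ‖x - y‖) := by
  obtain ⟨n, M, U, hU, hcone⟩ := hΩ z hz
  obtain ⟨ρ, hρ, hball⟩ := Metric.mem_nhds_iff.1 hU
  set C : NNReal := M * ‖n‖₊ + 1 with hC
  set r : ℝ := ρ / (1 + 2 * C) with hr
  have hrρ : r + C * (2 * r) = ρ := by rw [hr]; field_simp
  have hr0 : 0 < r := by positivity
  have hrle : r ≤ ρ := by rw [← hrρ]; exact le_add_of_nonneg_right (by positivity)
  have reach : ∀ x ∈ Ω ∩ Metric.ball z r, ∀ (δ : ℝ) (e : E), δ ≤ 2 * r → ‖e‖ ≤ δ →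
      segment ℝ x (x + ((M * δ) • n + e)) ⊆ Ω ∧ ‖x + ((M * δ) • n + e) - x‖ ≤ C * δ := by
    intro x hx δ e hδ he
    have hδ0 : 0 ≤ δ := (norm_nonneg e).trans he
    have hnorm : ‖(M * δ) • n + e‖ ≤ C * δ :=
      calc ‖(M * δ) • n + e‖ ≤ ‖(M * δ) • n‖ + ‖e‖ := norm_add_le _ _
        _ ≤ M * δ * ‖n‖ + δ := by
          rw [norm_smul, Real.norm_of_nonneg (mul_nonneg M.coe_nonneg hδ0)]
          gcongr
        _ = C * δ := by rw [hC]; push_cast; ring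
    refine ⟨segment_subset_of_cone hcone (convex_ball z ρ) hball
      ⟨hx.1, Metric.ball_subset_ball hrle hx.2⟩ (by gcongr) ?_, by rwa [add_sub_cancel_left]⟩
    have hCδ : C * δ ≤ C * (2 * r) := by gcongr
    rw [mem_ball_iff_norm, add_sub_right_comm]
    linarith [norm_add_le (x - z) ((M * δ) • n + e), mem_ball_iff_norm.1 hx.2]
  refine ⟨C, Metric.ball z r, Metric.ball_mem_nhds z hr0, fun x hx y hy => ?_⟩
  have hxy : ‖x - y‖ ≤ 2 * r := by
    linarith [norm_sub_le_norm_sub_add_norm_sub x z y, mem_ball_iff_norm.1 hx.2,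
      mem_ball_iff_norm'.1 hy.2]
  have hp : y + ((M * ‖x - y‖) • n + (x - y)) = x + ((M * ‖x - y‖) • n + 0) := by abel
  refine ⟨x + ((M * ‖x - y‖) • n + 0), reach x hx _ 0 hxy (by simp), ?_⟩
  rw [← hp]
  exact reach y hy _ (x - y) hxy le_rfl

theorem exists_cone_le_of_hasStrictFDerivAt {b : E → ℝ} {B : E →L[ℝ] ℝ} {z : E}
    (hb : HasStrictFDerivAt b B z) (hB : B ≠ 0) :
    ∃ (n : E) (M : NNReal), ∃ U ∈ 𝓝 z, ∀ x ∈ U, ∀ (s : ℝ) (e : E),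
      M * ‖e‖ ≤ s → x + (s • n + e) ∈ U → b (x + (s • n + e)) ≤ b x := by
  obtain ⟨w, hw⟩ := DFunLike.ne_iff.1 hB
  rw [zero_apply] at hw
  set n : E := (-2 / B w) • w with hn
  have hBn : B n = -2 := by simp [hn, hw]
  set ε : NNReal := (‖n‖₊ + 1)⁻¹ with hε
  have hεn : ε * ‖n‖ ≤ 1 := by
    rw [hε, NNReal.coe_inv, inv_mul_le_iff₀ (by positivity)]
    simp
  have hlittle := hb.isLittleO.def (c := (ε : ℝ)) (by positivity)
  rw [nhds_prod_eq] at hlittle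
  obtain ⟨U, hU, hstrict⟩ := Filter.mem_prod_self_iff.1 hlittle
  refine ⟨n, ‖B‖₊ + ε, U, hU, fun x hx s e he hmem => ?_⟩
  have herr : b (x + (s • n + e)) - b x - B (x + (s • n + e) - x) ≤
      ε * ‖x + (s • n + e) - x‖ := (le_abs_self _).trans (hstrict (mk_mem_prod hmem hx))
  rw [add_sub_cancel_left, map_add, map_smul, hBn, smul_eq_mul] at herr
  have hs : 0 ≤ s := le_trans (by positivity) he
  have hnorm : ε * ‖s • n + e‖ ≤ s + ε * ‖e‖ :=
    calc ε * ‖s • n + e‖ ≤ ε * (s * ‖n‖ + ‖e‖) := by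
          gcongr
          exact (norm_add_le _ _).trans_eq (by rw [norm_smul, Real.norm_of_nonneg hs])
      _ = s * (ε * ‖n‖) + ε * ‖e‖ := by ring
      _ ≤ s + ε * ‖e‖ := by gcongr; exact mul_le_of_le_one_right hs hεn
  have hBe := (le_abs_self _).trans (B.le_opNorm e)
  push_cast at he
  linarith

end Cone

theorem HasC2Boundary.hasUniformConeProperty {d : ℕ} {Ω : Set (Eucl d)} (hΩ2 : HasC2Boundary Ω)
    (hΩ : IsOpen Ω) : HasUniformConeProperty Ω := by
  intro z hz
  by_cases hzΩ : z ∈ Ω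
  · exact ⟨0, 0, Ω, hΩ.mem_nhds hzΩ, fun _ _ _ _ _ h => h⟩
  obtain ⟨U, b, hU, hzU, hb, hb', hΩU⟩ := hΩ2 z (by rw [hΩ.frontier_eq]; exact ⟨hz, hzΩ⟩)
  obtain ⟨n, M, V, hV, hcone⟩ := exists_cone_le_of_hasStrictFDerivAt
    ((hb.contDiffAt (hU.mem_nhds hzU)).hasStrictFDerivAt (by norm_num)) hb'
  refine ⟨n, M, U ∩ V, Filter.inter_mem (hU.mem_nhds hzU) hV, fun x hx s e he hmem => ?_⟩
  have hbx : b x < 0 := (hΩU.subset ⟨hx.1, hx.2.1⟩).2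
  exact (hΩU.superset ⟨hmem.1, (hcone x hx.2.2 s e he hmem.2).trans_lt hbx⟩).1

section Line

variable {E : Type*} [NormedAddCommGroup E] [NormedSpace ℝ E]

theorem hasDerivAt_comp_line {φ : E → ℝ} (hφ : Differentiable ℝ φ) (x q : E) (s : ℝ) :
    HasDerivAt (fun t : ℝ => φ (x + t • q)) (fderiv ℝ φ (x + s • q) q) s := by
  have hline : HasDerivAt (fun t : ℝ => x + t • q) q s := by
    simpa using ((hasDerivAt_id s).smul_const q).const_add x
  exact (hφ _).hasFDerivAt.comp_hasDerivAt s hline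

theorem add_fderiv_le_of_fderiv_fderiv_nonneg {f : E → ℝ} (hf : ContDiff ℝ 2 f)
    (h : ∀ x w, 0 ≤ fderiv ℝ (fderiv ℝ f) x w w) (x w : E) : f x + fderiv ℝ f x w ≤ f (x + w) := by
  have hf' : Differentiable ℝ (fderiv ℝ f) :=
    (hf.fderiv_right (m := 1) (by norm_num)).differentiable one_ne_zero
  have hder := hasDerivAt_comp_line (hf.differentiable two_ne_zero) x w
  have hder' (t : ℝ) : HasDerivAt (fun t : ℝ => fderiv ℝ f (x + t • w) w)
      (fderiv ℝ (fderiv ℝ f) (x + t • w) w w) t := by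
    have hdw : Differentiable ℝ fun y => fderiv ℝ f y w := hf'.clm_apply (differentiable_const w)
    convert hasDerivAt_comp_line hdw x w t using 1
    simp [fderiv_clm_apply hf'.differentiableAt (differentiableAt_const w)]
  have hconv : ConvexOn ℝ univ fun t : ℝ => f (x + t • w) :=
    Monotone.convexOn_univ_of_deriv (fun t => (hder t).differentiableAt) <| by
      rw [deriv_eq hder]
      exact monotone_of_hasDerivAt_nonneg hder' fun t => h _ w
  have hslope := hconv.le_slope_of_hasDerivAt (mem_univ 0) (mem_univ 1) one_pos (hder 0)
  simp only [slope_def_field, zero_smul, one_smul, add_zero, sub_zero, div_one] at hslope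
  linarith

end Line

section DistSq

variable {F : Type*} [NormedAddCommGroup F] [InnerProductSpace ℝ F]

theorem contDiff_dist_sq {n : WithTop ℕ∞} (y : F) : ContDiff ℝ n fun x => dist x y ^ 2 := by
  simp only [dist_eq_norm]
  exact (contDiff_id.sub contDiff_const).norm_sq ℝ

theorem gradient_sub_mul_dist_sq_self [CompleteSpace F] {φ : F → ℝ} {x₀ : F}
    (hφ : DifferentiableAt ℝ φ x₀) (k : ℝ) :
    gradient (fun x => φ x - k * dist x x₀ ^ 2) x₀ = gradient φ x₀ := by
  have hsq : HasFDerivAt (fun x => k * dist x x₀ ^ 2) (0 : F →L[ℝ] ℝ) x₀ := by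
    simpa [dist_eq_norm] using ((hasFDerivAt_id x₀).sub_const x₀).norm_sq.const_mul k
  have hsub := hφ.hasFDerivAt.sub hsq
  rw [sub_zero] at hsub
  exact congrArg _ hsub.fderiv

end DistSq

section Domination

variable {E : Type*} [NormedAddCommGroup E] [NormedSpace ℝ E] {Ω : Set E} {L : E → E → ℝ} {c : ℝ}

/-- `v` is dominated by `L + c` in `Ω`: it grows at most by the action of `L + c` along the segments
of `Ω` travelled at a constant velocity `q`. The classical notion takes all the absolutely
continuous curves of `Ω` into account, but these segments are enough to recover the eikonal
inequality. -/
def IsDominated (Ω : Set E) (L : E → E → ℝ) (c : ℝ) (v : E → ℝ) : Prop :=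
  ∀ (x q : E) ⦃a b : ℝ⦄, a ≤ b → (∀ s ∈ Icc a b, x + s • q ∈ Ω) →
    v (x + b • q) - v (x + a • q) ≤ ∫ s in a..b, (L (x + s • q) q + c)

theorem continuous_lagrangian_comp_line (hL : Continuous fun z : E × E => L z.1 z.2) (c : ℝ)
    (x q : E) : Continuous fun s : ℝ => L (x + s • q) q + c :=
  (hL.comp (by fun_prop : Continuous fun s : ℝ => (x + s • q, q))).add_const c

theorem isDominated_of_fderiv_le (hL : Continuous fun z : E × E => L z.1 z.2) {φ : E → ℝ}
    (hφ : ContDiff ℝ 1 φ) (h : ∀ x ∈ Ω, ∀ q, fderiv ℝ φ x q ≤ L x q + c) :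
    IsDominated Ω L c φ := by
  intro x q a b hab hmem
  have hcont : Continuous fun s : ℝ => fderiv ℝ φ (x + s • q) q :=
    ((hφ.continuous_fderiv one_ne_zero).comp (by fun_prop)).clm_apply continuous_const
  rw [← intervalIntegral.integral_eq_sub_of_hasDerivAt
    (fun s _ => hasDerivAt_comp_line (hφ.differentiable one_ne_zero) x q s)
    (hcont.intervalIntegrable a b)]
  exact intervalIntegral.integral_mono_on hab (hcont.intervalIntegrable a b)
    ((continuous_lagrangian_comp_line hL c x q).intervalIntegrable a b)
    fun s hs => h _ (hmem s hs) q

theorem isDominated_iUnion {ι : Sort*} {U : ι → Set E} {v : E → ℝ}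
    (hL : Continuous fun z : E × E => L z.1 z.2) (hU : ∀ i, IsOpen (U i))
    (h : ∀ i, IsDominated (U i) L c v) : IsDominated (⋃ i, U i) L c v := by
  intro x q a b hab hmem
  obtain ⟨t, ht₀, htmono, ⟨m, htm⟩, htU⟩ := exists_monotone_Icc_subset_open_cover_Icc hab
    (c := fun i => {s : Icc a b | x + (s : ℝ) • q ∈ U i})
    (fun i => (hU i).preimage (by fun_prop))
    (fun s _ => mem_iUnion.2 ((mem_iUnion.1 (hmem s s.2)).imp fun _ hi => hi))
  have hint := (continuous_lagrangian_comp_line hL c x q).intervalIntegrable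
    (μ := MeasureTheory.volume)
  suffices hstep : ∀ n, v (x + (t n : ℝ) • q) - v (x + a • q) ≤
      ∫ s in a..t n, (L (x + s • q) q + c) by simpa only [htm m le_rfl] using hstep m
  intro n
  induction n with
  | zero => simp [ht₀]
  | succ n ih =>
    obtain ⟨i, hi⟩ := htU n
    have hstep := h i x q (htmono n.le_succ) fun s hs =>
      hi (a := ⟨s, (t n).2.1.trans hs.1, hs.2.trans (t (n + 1)).2.2⟩) hs
    rw [← intervalIntegral.integral_add_adjacent_intervals (hint a (t n)) (hint _ _)]
    linarith

namespace IsDominated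

variable {u v : E → ℝ}

theorem add_const (hv : IsDominated Ω L c v) (k : ℝ) : IsDominated Ω L c fun x => v x + k := by
  intro x q a b hab hmem
  rw [add_sub_add_right_eq_sub]
  exact hv x q hab hmem

theorem mono {Ω' : Set E} (hv : IsDominated Ω L c v) (hsub : Ω' ⊆ Ω) : IsDominated Ω' L c v :=
  fun x q _ _ hab hmem => hv x q hab fun s hs => hsub (hmem s hs)

theorem congr (hv : IsDominated Ω L c v) (h : EqOn u v Ω) : IsDominated Ω L c u := by
  intro x q a b hab hmem
  rw [h (hmem a (left_mem_Icc.2 hab)), h (hmem b (right_mem_Icc.2 hab))]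
  exact hv x q hab hmem

theorem iSup {ι : Sort*} [Nonempty ι] {f : ι → E → ℝ} (hf : ∀ i, IsDominated Ω L c (f i))
    (hbdd : ∀ x ∈ Ω, BddAbove (range fun i => f i x)) :
    IsDominated Ω L c fun x => ⨆ i, f i x := by
  intro x q a b hab hmem
  rw [sub_le_iff_le_add]
  refine ciSup_le fun i => ?_
  linarith [hf i x q hab hmem, le_ciSup (hbdd _ (hmem a (left_mem_Icc.2 hab))) i]

theorem sup (hu : IsDominated Ω L c u) (hv : IsDominated Ω L c v) : IsDominated Ω L c (u ⊔ v) := by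
  intro x q a b hab hmem
  rw [sub_le_iff_le_add]
  refine sup_le ?_ ?_
  · linarith [hu x q hab hmem, le_sup_left (a := u (x + a • q)) (b := v (x + a • q)),
      Pi.sup_apply u v (x + a • q)]
  · linarith [hv x q hab hmem, le_sup_right (a := u (x + a • q)) (b := v (x + a • q)),
      Pi.sup_apply u v (x + a • q)]

theorem sub_le_mul_norm (hv : IsDominated Ω L c v) {K : ℝ}
    (hK : ∀ x ∈ Ω, ∀ q, ‖q‖ ≤ 1 → L x q + c ≤ K)
    (hL : Continuous fun z : E × E => L z.1 z.2) {x y : E} (hxy : segment ℝ x y ⊆ Ω) :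
    v y - v x ≤ K * ‖y - x‖ := by
  rcases eq_or_ne x y with rfl | hne
  · simp
  have hpos : 0 < ‖y - x‖ := norm_pos_iff.2 (sub_ne_zero.2 hne.symm)
  set q : E := ‖y - x‖⁻¹ • (y - x) with hq
  have hq1 : ‖q‖ ≤ 1 := by rw [hq, norm_smul, norm_inv, norm_norm, inv_mul_cancel₀ hpos.ne']
  have hmem : ∀ s ∈ Icc 0 ‖y - x‖, x + s • q ∈ Ω := fun s hs => hxy <| by
    rw [segment_eq_image', hq, smul_smul, ← div_eq_mul_inv]
    exact mem_image_of_mem _ ⟨div_nonneg hs.1 hpos.le, div_le_one_of_le₀ hs.2 hpos.le⟩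
  calc v y - v x = v (x + ‖y - x‖ • q) - v (x + (0 : ℝ) • q) := by
        rw [hq, smul_inv_smul₀ hpos.ne', add_sub_cancel, zero_smul, add_zero]
    _ ≤ ∫ s in 0..‖y - x‖, (L (x + s • q) q + c) := hv x q hpos.le hmem
    _ ≤ ∫ _ in 0..‖y - x‖, K := intervalIntegral.integral_mono_on hpos.le
        ((continuous_lagrangian_comp_line hL c x q).intervalIntegrable _ _)
        intervalIntegrable_const fun s hs => hK _ (hmem s hs) q hq1
    _ = K * ‖y - x‖ := by
        rw [intervalIntegral.integral_const, sub_zero, smul_eq_mul, mul_comm]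

theorem fderiv_le (hv : IsDominated Ω L c v) (hL : Continuous fun z : E × E => L z.1 z.2)
    (hΩ : IsOpen Ω) {φ : E → ℝ} (hφ : Differentiable ℝ φ) {x₀ : E} (hx₀ : x₀ ∈ Ω)
    (hmax : IsLocalMax (fun x => v x - φ x) x₀) (q : E) : fderiv ℝ φ x₀ q ≤ L x₀ q + c := by
  have hline : Filter.Tendsto (fun s : ℝ => x₀ + s • q) (𝓝 0) (𝓝 x₀) :=
    Continuous.tendsto' (by fun_prop) _ _ (by simp)
  have hcont := continuous_lagrangian_comp_line hL c x₀ q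
  have hmin : IsLocalMinOn (fun s : ℝ => φ (x₀ + s • q) - ∫ t in 0..s, (L (x₀ + t • q) q + c))
      (Iic 0) 0 := by
    have hmem : ∀ᶠ s : ℝ in 𝓝 0, ∀ t ∈ Icc s 0, x₀ + t • q ∈ Ω :=
      (Filter.tendsto_id.Icc tendsto_const_nhds).eventually
        (hline.eventually (hΩ.mem_nhds hx₀)).smallSets
    filter_upwards [nhdsWithin_le_nhds hmem, nhdsWithin_le_nhds (hline.eventually hmax),
      self_mem_nhdsWithin] with s hs hsmax hs0
    have hdom := hv x₀ q hs0 hs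
    rw [intervalIntegral.integral_symm] at hdom
    simp only [zero_smul, add_zero, intervalIntegral.integral_same] at hdom ⊢
    linarith
  have hder := (hasDerivAt_comp_line hφ x₀ q 0).sub (hcont.integral_hasStrictDerivAt 0 0).hasDerivAt
  have hnonneg := hmin.hasFDerivWithinAt_nonneg hder.hasFDerivAt.hasFDerivWithinAt
    (y := -1) (mem_posTangentConeAt_of_segment_subset ?_)
  · simpa using hnonneg
  · rw [zero_add, segment_symm, segment_eq_Icc (by norm_num)]
    exact Icc_subset_Iic_self

end IsDominated

end Domination

section Perron

variable {E : Type*} [NormedAddCommGroup E] [NormedSpace ℝ E] {Ω : Set E} {L : E → E → ℝ} {c : ℝ}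
  {z : E}

/-- The competitors in Perron's method: the functions dominated by `L + c` in `Ω` which are
continuous on the closure of `Ω` and vanish at the base point `z`. -/
def dominatedFamily (Ω : Set E) (L : E → E → ℝ) (c : ℝ) (z : E) : Set (E → ℝ) :=
  {v | ContinuousOn v (closure Ω) ∧ v z = 0 ∧ IsDominated Ω L c v}

/-- The upper envelope of the dominated functions vanishing at `z`, which is the solution produced
by Perron's method. It is a junk `0` where these functions are not bounded above. -/
noncomputable def dominatedEnvelope (Ω : Set E) (L : E → E → ℝ) (c : ℝ) (z x : E) : ℝ :=
  ⨆ v : dominatedFamily Ω L c z, (v : E → ℝ) x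

theorem zero_mem_dominatedFamily (h : ∀ x v, 0 ≤ L x v + c) :
    (0 : E → ℝ) ∈ dominatedFamily Ω L c z := by
  refine ⟨continuousOn_const, rfl, fun x q a b hab _ => ?_⟩
  rw [Pi.zero_apply, Pi.zero_apply, sub_zero]
  exact intervalIntegral.integral_nonneg hab fun s _ => h _ _

theorem IsDominated.lipschitzOnWith {v : E → ℝ} (hv : IsDominated Ω L c v)
    (hL : Continuous fun z : E × E => L z.1 z.2) {K C : NNReal}
    (hK : ∀ x ∈ Ω, ∀ q, ‖q‖ ≤ 1 → L x q + c ≤ K) {V : Set E}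
    (hV : ∀ x ∈ Ω ∩ V, ∀ y ∈ Ω ∩ V, ∃ p, (segment ℝ x p ⊆ Ω ∧ ‖p - x‖ ≤ C * ‖x - y‖) ∧
      (segment ℝ y p ⊆ Ω ∧ ‖p - y‖ ≤ C * ‖x - y‖)) :
    LipschitzOnWith (2 * K * C) v (Ω ∩ V) := by
  refine LipschitzOnWith.of_le_add_mul _ fun x hx y hy => ?_
  obtain ⟨p, ⟨hxp, hpx⟩, hyp, hpy⟩ := hV x hx y hy
  have hfrom : v p - v y ≤ K * (C * ‖x - y‖) :=
    (hv.sub_le_mul_norm hK hL hyp).trans (by gcongr)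
  have hto : v x - v p ≤ K * (C * ‖x - y‖) :=
    (hv.sub_le_mul_norm hK hL (segment_symm ℝ x p ▸ hxp)).trans (by rw [norm_sub_rev]; gcongr)
  rw [dist_eq_norm]
  push_cast
  linarith

theorem locallyEquiLipschitzOn_dominatedFamily [ProperSpace E]
    (hL : Continuous fun z : E × E => L z.1 z.2) (hcone : HasUniformConeProperty Ω)
    (hΩb : Bornology.IsBounded Ω) :
    LocallyEquiLipschitzOn (closure Ω) fun (v : dominatedFamily Ω L c z) => (v : E → ℝ) := by
  intro y hy
  obtain ⟨K, hK⟩ := (hΩb.isCompact_closure.prod (isCompact_closedBall (0 : E) 1)).bddAbove_image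
    (hL.add_const c).continuousOn
  have hKΩ : ∀ x ∈ Ω, ∀ q, ‖q‖ ≤ 1 → L x q + c ≤ K.toNNReal := fun x hx q hq =>
    (hK (mem_image_of_mem _ (mk_mem_prod (subset_closure hx) (mem_closedBall_zero_iff.2 hq)))).trans
      (Real.le_coe_toNNReal K)
  obtain ⟨C, V, hV, hCV⟩ := hcone.exists_segment_subset hy
  have hVΩ : closure Ω ∩ interior V ⊆ closure (Ω ∩ V) :=
    isOpen_interior.closure_inter.trans (closure_mono (inter_subset_inter_right Ω interior_subset))
  refine ⟨2 * K.toNNReal * C, closure Ω ∩ interior V,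
    Filter.inter_mem self_mem_nhdsWithin (mem_nhdsWithin_of_mem_nhds (interior_mem_nhds.2 hV)),
    fun v => LipschitzOnWith.mono ?_ hVΩ⟩
  exact (lipschitzOnWith_closure_iff (v.2.1.mono (closure_mono inter_subset_left))).2
    (v.2.2.2.lipschitzOnWith hL hKΩ hCV)

theorem bddAbove_range_dominatedFamily [ProperSpace E]
    (hL : Continuous fun z : E × E => L z.1 z.2) (hcone : HasUniformConeProperty Ω)
    (hΩb : Bornology.IsBounded Ω) (hconn : IsPreconnected (closure Ω)) (hz : z ∈ closure Ω)
    {x : E} (hx : x ∈ closure Ω) :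
    BddAbove (range fun v : dominatedFamily Ω L c z => (v : E → ℝ) x) :=
  (locallyEquiLipschitzOn_dominatedFamily hL hcone hΩb).bddAbove_range hconn hz hx
    ⟨0, forall_mem_range.2 fun v => v.2.2.1.le⟩

theorem dominatedEnvelope_mem [ProperSpace E]
    (hL : Continuous fun z : E × E => L z.1 z.2) (hcone : HasUniformConeProperty Ω)
    (hΩb : Bornology.IsBounded Ω) (hconn : IsPreconnected (closure Ω)) (hz : z ∈ closure Ω)
    (h : ∀ x v, 0 ≤ L x v + c) : dominatedEnvelope Ω L c z ∈ dominatedFamily Ω L c z := by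
  have : Nonempty (dominatedFamily Ω L c z) := ⟨⟨_, zero_mem_dominatedFamily h⟩⟩
  have hbdd := fun x (hx : x ∈ closure Ω) =>
    bddAbove_range_dominatedFamily (c := c) hL hcone hΩb hconn hz hx
  refine ⟨?_, (iSup_congr fun v => v.2.2.1).trans ciSup_const,
    IsDominated.iSup (fun v => v.2.2.2) fun x hx => hbdd x (subset_closure hx)⟩
  exact ((locallyEquiLipschitzOn_dominatedFamily hL hcone hΩb).locallyLipschitzOn_iSup
    hbdd).continuousOn

/-- The bump: `u` is replaced by its maximum with a translate of `ψ` that exceeds `u` at `x₀`, but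
stays below it out of a small ball. -/
theorem exists_mem_dominatedFamily_gt (hL : Continuous fun z : E × E => L z.1 z.2)
    (hΩ : IsOpen Ω) (hz : z ∈ closure Ω) {u ψ : E → ℝ} {x₀ : E}
    (hu : u ∈ dominatedFamily Ω L c z) (hψ : ContDiff ℝ 1 ψ) (hne : x₀ ≠ z)
    (htouch : ∀ x ∈ closure Ω, u x₀ - ψ x₀ + dist x x₀ ^ 2 ≤ u x - ψ x)
    (hsub : ∀ᶠ x in 𝓝 x₀, ∀ q, fderiv ℝ ψ x q ≤ L x q + c) :
    ∃ w ∈ dominatedFamily Ω L c z, u x₀ < w x₀ := by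
  obtain ⟨huc, huz, hud⟩ := hu
  obtain ⟨r, hr, hball⟩ := Metric.eventually_nhds_iff_ball.1
    (hsub.and (isOpen_ne.eventually_mem hne))
  set a : ℝ := u x₀ - ψ x₀ + r ^ 2 / 2 with ha
  have hr2 : 0 < r ^ 2 / 2 := by positivity
  have houtside : ∀ x ∈ closure Ω, x ∉ Metric.ball x₀ r → a < u x - ψ x := by
    intro x hx hxr
    have hdist : r ^ 2 ≤ dist x x₀ ^ 2 := by gcongr; exact not_lt.1 hxr
    linarith [htouch x hx]
  have hΩ_eq : Ω = ⋃ i : Bool, cond i (Ω ∩ Metric.ball x₀ r) (Ω ∩ {x | a < u x - ψ x}) := by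
    rw [← union_eq_iUnion, ← inter_union_distrib_left, left_eq_inter]
    exact fun x hx => or_iff_not_imp_left.2 (houtside x (subset_closure hx))
  have hopen : IsOpen (Ω ∩ {x | a < u x - ψ x}) :=
    ((huc.mono subset_closure).sub hψ.continuous.continuousOn).isOpen_inter_preimage hΩ isOpen_Ioi
  have hsup : ∀ x, a < u x - ψ x → (u ⊔ fun x => ψ x + a) x = u x := fun x hx =>
    sup_eq_left.2 (by linarith)
  refine ⟨u ⊔ fun x => ψ x + a, ⟨huc.sup (hψ.continuous.add_const a).continuousOn, ?_, ?_⟩, ?_⟩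
  · exact (hsup z (houtside z hz fun h => (hball z h).2 rfl)).trans huz
  · rw [hΩ_eq]
    refine isDominated_iUnion hL (Bool.forall_bool.2 ⟨hopen, hΩ.inter Metric.isOpen_ball⟩)
      (Bool.forall_bool.2 ⟨?_, ?_⟩)
    · exact (hud.mono inter_subset_left).congr fun x hx => hsup x hx.2
    · exact (hud.mono inter_subset_left).sup ((isDominated_of_fderiv_le hL hψ
        fun x hx => (hball x hx.2).1).add_const a)
  · exact lt_sup_of_lt_right (by linarith : u x₀ < ψ x₀ + a)

end Perron

section Hamiltonian

variable {d : ℕ} {L : Eucl d → Eucl d → ℝ}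

/-- `L` grows faster than linearly in the velocity, uniformly in the position, as in the definition
of Tonelli Lagrangians. -/
def IsSuperlinear (L : Eucl d → Eucl d → ℝ) : Prop :=
  ∀ K : ℝ, ∃ C : ℝ, ∀ x v : Eucl d, K * ‖v‖ - C ≤ L x v

theorem hamiltonian_le {x p : Eucl d} {c : ℝ} (h : ∀ v, inner ℝ p v ≤ L x v + c) :
    hamiltonian L x p ≤ c :=
  ciSup_le fun v => sub_le_iff_le_add'.2 (h v)

namespace IsSuperlinear

theorem bddAbove_range (hsl : IsSuperlinear L) (x p : Eucl d) :
    BddAbove (range fun v : Eucl d => inner ℝ p v - L x v) := by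
  obtain ⟨C, hC⟩ := hsl ‖p‖
  refine ⟨C, forall_mem_range.2 fun v => ?_⟩
  linarith [hC x v, real_inner_le_norm p v]

theorem inner_sub_le_hamiltonian (hsl : IsSuperlinear L) (x p v : Eucl d) :
    inner ℝ p v - L x v ≤ hamiltonian L x p :=
  le_ciSup (hsl.bddAbove_range x p) v

theorem neg_le_hamiltonian (hsl : IsSuperlinear L) (x p : Eucl d) :
    -L x 0 ≤ hamiltonian L x p := by
  simpa using hsl.inner_sub_le_hamiltonian x p 0

/-- Large velocities are controlled by superlinearity, the other ones by compactness. -/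
theorem eventually_inner_le (hsl : IsSuperlinear L)
    (hL : Continuous fun z : Eucl d × Eucl d => L z.1 z.2) {P : Eucl d → Eucl d} {x₀ : Eucl d}
    (hP : ContinuousAt P x₀) {c : ℝ} (h : hamiltonian L x₀ (P x₀) < c) :
    ∀ᶠ x in 𝓝 x₀, ∀ v, inner ℝ (P x) v ≤ L x v + c := by
  obtain ⟨C, hC⟩ := hsl (‖P x₀‖ + 2)
  have hbounded : ∀ᶠ x in 𝓝 x₀, ‖P x‖ < ‖P x₀‖ + 1 :=
    hP.norm.eventually_lt continuousAt_const (lt_add_one _)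
  have hsmall : ∀ᶠ x in 𝓝 x₀, ∀ v ∈ Metric.closedBall (0 : Eucl d) (C - c),
      inner ℝ (P x) v < L x v + c := by
    refine (isCompact_closedBall _ _).eventually_forall_of_forall_eventually fun v _ => ?_
    have hPfst : ContinuousAt (fun z : Eucl d × Eucl d => P z.1) (x₀, v) :=
      hP.comp (f := Prod.fst) continuousAt_fst
    refine (hPfst.inner continuousAt_snd).eventually_lt (hL.add_const c).continuousAt ?_
    linarith [hsl.inner_sub_le_hamiltonian x₀ (P x₀) v]
  filter_upwards [hbounded, hsmall] with x hPx hsmallx v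
  rcases le_or_gt ‖v‖ (C - c) with hv | hv
  · exact (hsmallx v (mem_closedBall_zero_iff.2 hv)).le
  · have hinner : inner ℝ (P x) v ≤ (‖P x₀‖ + 1) * ‖v‖ :=
      (real_inner_le_norm _ _).trans (by gcongr)
    linarith [hC x v]

end IsSuperlinear

namespace IsTonelli

theorem add_fderiv_le (hL : IsTonelli L) (x v : Eucl d) :
    L x 0 + fderiv ℝ (L x) 0 v ≤ L x v := by
  have hC2 : ContDiff ℝ 2 (L x) :=
    hL.contDiff.comp (contDiff_const.prodMk contDiff_id : ContDiff ℝ 2 fun v : Eucl d => (x, v))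
  have hnonneg : ∀ v w, 0 ≤ fderiv ℝ (fderiv ℝ (L x)) v w w := fun v w => by
    rcases eq_or_ne w 0 with rfl | hw
    · simp
    · exact (hL.posDef x v w hw).le
  simpa only [zero_add] using add_fderiv_le_of_fderiv_fderiv_nonneg hC2 hnonneg 0 v

/-- For the momentum `p` conjugate to the zero velocity, `H(x,-p) = H(x,p) = -L(x,0)`. -/
theorem le_of_reversible (hL : IsTonelli L) (hrev : IsReversible (hamiltonian L))
    (x v : Eucl d) : L x 0 ≤ L x v := by
  set p : Eucl d := gradient (L x) 0
  have hp : ∀ w, inner ℝ p w = fderiv ℝ (L x) 0 w := fun w => inner_gradient_left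
  have hHp : hamiltonian L x (-p) ≤ -L x 0 := by
    rw [hrev]
    exact hamiltonian_le fun w => by rw [hp]; linarith [hL.add_fderiv_le x w]
  have hFenchel := IsSuperlinear.inner_sub_le_hamiltonian hL.superlinear x (-p) v
  rw [inner_neg_left, hp] at hFenchel
  linarith [hL.add_fderiv_le x v]

end IsTonelli

theorem negativeActionLevels_eq_Iio {z : Eucl d} (hmin : ∀ y v, L z 0 ≤ L y v) :
    negativeActionLevels L = Iio (-L z 0) := by
  refine Subset.antisymm ?_ fun k hk => ?_
  · rintro k ⟨a, b, γ, hab, -, -, -, hneg⟩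
    refine mem_Iio.2 <| not_le.1 fun hk =>
      hneg.not_ge (intervalIntegral.integral_nonneg hab.le fun s _ => ?_)
    linarith [hmin (γ s) (deriv γ s), hk]
  · refine ⟨0, 1, fun _ => z, one_pos, ?_, rfl, ?_, ?_⟩
    · exact ((LipschitzWith.const z).lipschitzOnWith (K := 0)).absolutelyContinuousOnInterval
    · simp only [deriv_const, intervalIntegrable_const]
    · simpa using lt_neg_iff_add_neg'.1 hk

theorem maneCriticalValue_eq {z : Eucl d} (hmin : ∀ y v, L z 0 ≤ L y v) :
    maneCriticalValue L = -L z 0 := by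
  rw [maneCriticalValue, negativeActionLevels_eq_Iio hmin, csSup_Iio]

end Hamiltonian

section Viscosity

variable {d : ℕ} {Ω : Set (Eucl d)} {H : Eucl d → Eucl d → ℝ} {c : ℝ} {u : Eucl d → ℝ}

theorem IsViscositySubsolutionOn.le_of_mem_closure (h : IsViscositySubsolutionOn Ω H c u)
    (hΩ : IsOpen Ω) (hu : ContinuousOn u Ω) {f : Eucl d → ℝ} (hf : Continuous f)
    (hfH : ∀ x ∈ Ω, ∀ p, f x ≤ H x p) {z : Eucl d} (hz : z ∈ closure Ω) : f z ≤ c := by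
  refine closure_minimal (fun y hy => ?_) (isClosed_Iic.preimage hf) hz
  refine mem_preimage.2 <| le_of_not_gt fun (hcf : c < f y) => ?_
  have hnhds : Ω ∩ f ⁻¹' Ioi c ∈ 𝓝 y :=
    Filter.inter_mem (hΩ.mem_nhds hy) ((isOpen_Ioi.preimage hf).mem_nhds hcf)
  obtain ⟨r, hr, hball⟩ := Metric.nhds_basis_closedBall.mem_iff.1 hnhds
  obtain ⟨k, x, hx, hmax⟩ := exists_isLocalMax_sub_mul_dist_sq hr
    (hu.mono (hball.trans inter_subset_left))
  have hφ : ContDiff ℝ 1 fun x : Eucl d => k * dist x y ^ 2 :=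
    contDiff_const.mul (contDiff_dist_sq y)
  have hxΩ := hball (Metric.ball_subset_closedBall hx)
  exact ((hfH x hxΩ.1 _).trans (h _ hφ x hxΩ.1 (hmax.on Ω))).not_gt hxΩ.2

theorem IsViscositySupersolutionOn.exists_le {S : Set (Eucl d)}
    (h : IsViscositySupersolutionOn S H c u) (hS : IsCompact S) (hne : S.Nonempty)
    (hu : ContinuousOn u S) : ∃ x ∈ S, c ≤ H x 0 := by
  obtain ⟨x, hx, hmin⟩ := hS.exists_isMinOn hne hu
  refine ⟨x, hx, ?_⟩
  simpa only [gradient_fun_const] using h (fun _ => 0) contDiff_const x hx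
    (by simpa only [sub_zero] using hmin.localize)

variable {L : Eucl d → Eucl d → ℝ} {z : Eucl d}

theorem IsDominated.isViscositySubsolutionOn (hu : IsDominated Ω L c u)
    (hL : Continuous fun z : Eucl d × Eucl d => L z.1 z.2) (hΩ : IsOpen Ω) :
    IsViscositySubsolutionOn Ω (hamiltonian L) c u := fun _ hφ _ hx₀ hmax =>
  hamiltonian_le fun q => inner_gradient_left.trans_le
    (hu.fderiv_le hL hΩ (hφ.differentiable one_ne_zero) hx₀ (hmax.isLocalMax (hΩ.mem_nhds hx₀)) q)

theorem isViscositySupersolutionOn_dominatedEnvelope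
    (hL : Continuous fun z : Eucl d × Eucl d => L z.1 z.2) (hsl : IsSuperlinear L)
    (hΩ : IsOpen Ω) (hcone : HasUniformConeProperty Ω) (hΩb : Bornology.IsBounded Ω)
    (hconn : IsPreconnected (closure Ω)) (hz : z ∈ closure Ω) (hmin : ∀ y v, L z 0 ≤ L y v) :
    IsViscositySupersolutionOn (closure Ω) (hamiltonian L) (-L z 0)
      (dominatedEnvelope Ω L (-L z 0) z) := by
  intro φ hφ x₀ hx₀ hloc
  rcases eq_or_ne x₀ z with rfl | hne
  · exact hsl.neg_le_hamiltonian _ _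
  by_contra! hlt
  have hmem := dominatedEnvelope_mem hL hcone hΩb hconn hz fun x v =>
    le_add_neg_iff_le.2 (hmin x v)
  obtain ⟨k, hk⟩ := exists_forall_le_add_mul_dist_sq
    (hΩb.isCompact_closure.bddBelow_image (hmem.1.sub hφ.continuous.continuousOn)) hloc
  set ψ : Eucl d → ℝ := fun x => φ x - (k + 1) * dist x x₀ ^ 2 with hψ_def
  have hψ : ContDiff ℝ 1 ψ := hφ.sub (contDiff_const.mul (contDiff_dist_sq x₀))
  have hψ_grad : Continuous (gradient ψ) :=
    (InnerProductSpace.toDual ℝ (Eucl d)).symm.continuous.comp (hψ.continuous_fderiv one_ne_zero)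
  rw [← gradient_sub_mul_dist_sq_self (hφ.differentiable one_ne_zero x₀) (k + 1)] at hlt
  have htouch : ∀ x ∈ closure Ω, dominatedEnvelope Ω L (-L z 0) z x₀ - ψ x₀ + dist x x₀ ^ 2 ≤
      dominatedEnvelope Ω L (-L z 0) z x - ψ x := fun x hx => by
    have hkx := hk x hx
    simp only [Pi.sub_apply] at hkx
    simp only [hψ_def, dist_self]
    linarith
  obtain ⟨w, hw, hgt⟩ := exists_mem_dominatedFamily_gt hL hΩ hz hmem hψ hne htouch
    ((hsl.eventually_inner_le hL hψ_grad.continuousAt hlt).mono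
      fun x hx q => inner_gradient_left.symm.trans_le (hx q))
  exact hgt.not_ge
    (le_ciSup (bddAbove_range_dominatedFamily hL hcone hΩb hconn hz hx₀) ⟨w, hw⟩)

theorem stateConstraintSolvable_iff
    (hL : Continuous fun z : Eucl d × Eucl d => L z.1 z.2) (hsl : IsSuperlinear L)
    (hΩ : IsOpen Ω) (hcone : HasUniformConeProperty Ω) (hΩb : Bornology.IsBounded Ω)
    (hconn : IsPreconnected (closure Ω)) (hz : z ∈ closure Ω) (hmin : ∀ y v, L z 0 ≤ L y v) :
    StateConstraintSolvable Ω (hamiltonian L) c ↔ c = -L z 0 := by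
  constructor
  · rintro ⟨u, hu, hsub, hsup⟩
    obtain ⟨x, -, hx⟩ := hsup.exists_le hΩb.isCompact_closure ⟨z, hz⟩ hu
    have hrest : Continuous fun x => -L x 0 := (hL.comp (by fun_prop :
      Continuous fun x : Eucl d => (x, (0 : Eucl d)))).neg
    refine le_antisymm (hx.trans (hamiltonian_le fun v => ?_))
      (hsub.le_of_mem_closure hΩ (hu.mono subset_closure) hrest
        (fun x _ p => hsl.neg_le_hamiltonian x p) hz)
    rw [inner_zero_left]
    exact le_add_neg_iff_le.2 (hmin x v)
  · rintro rfl
    have hmem := dominatedEnvelope_mem hL hcone hΩb hconn hz fun x v =>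
      le_add_neg_iff_le.2 (hmin x v)
    exact ⟨_, hmem.1, hmem.2.2.isViscositySubsolutionOn hL hΩ,
      isViscositySupersolutionOn_dominatedEnvelope hL hsl hΩ hcone hΩb hconn hz hmin⟩

end Viscosity

theorem proposition3p3_general {d : ℕ} {Ω : Set (Eucl d)} (hΩ : IsOpen Ω)
    (hcone : HasUniformConeProperty Ω) (hΩb : Bornology.IsBounded Ω)
    (hconn : IsPreconnected (closure Ω)) {L : Eucl d → Eucl d → ℝ}
    (hL : Continuous fun z : Eucl d × Eucl d => L z.1 z.2) (hsl : IsSuperlinear L) {z : Eucl d}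
    (hz : z ∈ closure Ω) (hmin : ∀ y v, L z 0 ≤ L y v) :
    (∃! c : ℝ, StateConstraintSolvable Ω (hamiltonian L) c) ∧
    IsLUB (negativeActionLevels L) (maneCriticalValue L) ∧
    constrainedCriticalValue Ω (hamiltonian L) = maneCriticalValue L ∧
    IsLeast (Set.range fun x => L x 0) (-maneCriticalValue L) := by
  have hsolvable {c : ℝ} : StateConstraintSolvable Ω (hamiltonian L) c ↔ c = -L z 0 :=
    stateConstraintSolvable_iff hL hsl hΩ hcone hΩb hconn hz hmin
  rw [maneCriticalValue_eq hmin, negativeActionLevels_eq_Iio hmin, neg_neg]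
  exact ⟨⟨_, hsolvable.2 rfl, fun _ => hsolvable.1⟩, isLUB_Iio,
    hsolvable.1 (Classical.epsilon_spec ⟨_, hsolvable.2 rfl⟩),
    mem_range_self z, forall_mem_range.2 fun y => hmin y 0⟩

/-- The first conjunct says that `c_H` is well defined, the second that `c_L` is a genuine
supremum, the third that they agree, the fourth that the common value is `-min_x L(x,0)`. -/
theorem proposition3p3 {d : ℕ} (Ω : Set (Eucl d)) (hΩo : IsOpen Ω) (hΩc : IsConnected Ω)
    (hΩb : Bornology.IsBounded Ω) (hΩ2 : HasC2Boundary Ω)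
    (L : Eucl d → Eucl d → ℝ) (hL : IsTonelli L) (hrev : IsReversible (hamiltonian L))
    (hA1 : ({x | ∀ y, L x 0 ≤ L y 0} ∩ closure Ω).Nonempty) :
    (∃! c : ℝ, StateConstraintSolvable Ω (hamiltonian L) c) ∧
    IsLUB (negativeActionLevels L) (maneCriticalValue L) ∧
    constrainedCriticalValue Ω (hamiltonian L) = maneCriticalValue L ∧
    IsLeast (Set.range fun x => L x 0) (-maneCriticalValue L) := by
  obtain ⟨z, hz, hzΩ⟩ := hA1
  exact proposition3p3_general hΩo (hΩ2.hasUniformConeProperty hΩo) hΩb hΩc.isPreconnected.closure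
    hL.contDiff.continuous hL.superlinear hzΩ fun y v => (hz y).trans (hL.le_of_reversible hrev y v)
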